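/- **Setting.** Let $\mathcal A$ be a hyperplane arrangement in $\mathbb R^n$, i.e. a finite set of linear subspaces of codimension $1$. For a subspace $H$ with equations $\sum_i a_{ij}x_i=0$ ($1\le j\le r$) put $\mathrm{supp}(H)=\{i: a_{ij}\ne 0\text{ for some }j\}$. For $\mathbf m\in\mathbb Z_{\ge0}^n$ write $|\mathbf m|=\sum_i m_i$, $\mathbf m!=\prod_i m_i!$, $\mathrm{supp}(\mathbf m)=\{i:m_i\neq0\}$. The characteristic polynomial of a finite set $\mathcal B$ of subspaces of a finite-dimensional real vector space $V$ is $\chi_{\mathcal B}(t)=\sum_{X\in L(\mathcal B)}\mu(V,X)\,t^{\dim X}$, where $L(\mathcal B)$ is the set of all intersections of members of $\mathcal B$ (including $V$), ordered by reverse inclusion, and $\mu$ is its Möbius function. Let $\mathcal A(\mathbf m)$ be the arrangement in $\mathbb R^{|\mathbf m|}$, with coordinates $x_{ir}$ ($1\le i\le n$, $1\le r\le m_i$), that consists of the hyperplanes $x_{ir}=x_{is}$ ($r\ne s$) and, for every $H\in\mathcal A$ with $\mathrm{supp}(H)\subseteq\mathrm{supp}(\mathbf m)$ and every tuple $(k_i)_{i\in\mathrm{supp}(\mathbf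 m)}$ with $1\le k_i\le m_i$, of the hyperplane obtained from the equation of $H$ by replacing each $x_i$ by $x_{ik_i}$. If the members of $\mathcal A$ are given by equations with integer coefficients, a multi-coloring of $\mathcal A$ associated to $\mathbf m$ over a finite field $\mathbb F_q$ is a tuple $(C_1,\dots,C_n)$ of subsets of $\mathbb F_q$ with $|C_i|=m_i$ such that for no $H\in\mathcal A$ is there $x\in\mathbb F_q^n$ that satisfies the equations of $H$ in $\mathbb F_q$ and has $x_i\in C_i$ for all $i\in\mathrm{supp}(H)$. Let $\Pi_{\mathbf m}(t)\in\mathbb Q[t]$ be the polynomial such that $\Pi_{\mathbf m}(q)$ is the number of these multi-colorings for all prime powers $q$ of sufficiently large characteristic. (If $\mathcal A$ cannot be given by integer equations, put $\Pi_{\mathbf m}=\chi_{\mathcal A(\mathbf m)}/\mathbf m!$.) With a variable $t$, the independence series of $\mathcal A$ is $$I(\mathcal A,x)=\Big(\sum_{\mathbf m}\Pi_{\mathbf m}(t)\,x^{\mathbf m}\Big)^{1/t}=\exp\Big(\tfrac1t\log\sum_{\mathbf m}\Pi_{\mathbf m}(t)\,x^{\mathbf m}\Big)\in\mathbb Q(t)[[x_1,\dots,x_n]],$$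 and for $q\in\mathbb Z$ the series $I(\mathcal A,-x)^{q}\in\mathbb Q[[x_1,\dots,x_n]]$ is the specialization at $t=q$ of $I(\mathcal A,-x)^{t}=\exp(t\log I(\mathcal A,-x))$. **Statement.** For every hyperplane arrangement $\mathcal A$ in $\mathbb R^n$: 1. if $\mathcal A$ is given by integer equations, the polynomials $\Pi_{\mathbf m}$ exist, i.e. for every choice of integer equations and every $\mathbf m$, $\Pi_{\mathbf m}(q)$ is the number of multi-colorings of $\mathcal A$ associated to $\mathbf m$ over $\mathbb F_q$ for all prime powers $q$ of sufficiently large characteristic; 2. $I(\mathcal A,x)^t=\sum_{\mathbf m}\Pi_{\mathbf m}(t)x^{\mathbf m}$ and $I(\mathcal A,-x)^t=\sum_{\mathbf m}(-1)^{|\mathbf m|}\Pi_{\mathbf m}(t)x^{\mathbf m}$, so that the coefficients are polynomials in $t$ and can be specialized; 3. for every $q\in\mathbb Z_{\ge0}$ the series $I(\mathcal A,-x)^{-q}$ has nonnegative coefficients; the coefficient of $x^{\mathbf m}$ is $(-1)^{|\mathbf m|}\chi_{\mathcal A(\mathbf m)}(-q)/\mathbf m!\ \ge 0$. -/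

import Mathlib

open scoped Polynomial

noncomputable section

namespace SubspaceArrangement

/-! ### Arrangements, intersection poset, characteristic polynomial -/

/-- `𝒜` is a hyperplane arrangement in `ℝ^n`: every member has codimension `1`. -/
def IsHyperplaneArrangement {n : ℕ} (A : Finset (Submodule ℝ (Fin n → ℝ))) : Prop :=
  ∀ H ∈ A, Module.finrank ℝ H + 1 = n

open Classical in
/-- The set of all intersections of members of `A`; the empty intersection is the whole space. -/
def flats {V : Type} [AddCommGroup V] [Module ℝ V] (A : Finset (Submodule ℝ V)) :
    Finset (Submodule ℝ V) :=
  A.powerset.image fun B => B.inf id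

/-- The intersection poset `L(A)`: the flats, ordered by *reverse* inclusion. -/
abbrev IntersectionPoset {V : Type} [AddCommGroup V] [Module ℝ V] (A : Finset (Submodule ℝ V)) :
    Type :=
  (flats A)ᵒᵈ

theorem top_mem_flats {V : Type} [AddCommGroup V] [Module ℝ V] (A : Finset (Submodule ℝ V)) :
    (⊤ : Submodule ℝ V) ∈ flats A := by
  classical
  exact Finset.mem_image.mpr ⟨∅, by simp, by simp⟩

/-- The flat of `L(A)` that is the whole space. -/
def wholeSpace {V : Type} [AddCommGroup V] [Module ℝ V] (A : Finset (Submodule ℝ V)) :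
    IntersectionPoset A :=
  OrderDual.toDual ⟨⊤, top_mem_flats A⟩

open Classical in
/-- The Möbius function of the finite poset `L(A)`. -/
def moebius {V : Type} [AddCommGroup V] [Module ℝ V] (A : Finset (Submodule ℝ V))
    (X Y : IntersectionPoset A) : ℤ :=
  letI : LocallyFiniteOrder (IntersectionPoset A) := Fintype.toLocallyFiniteOrder
  IncidenceAlgebra.mu ℤ X Y

/-- The characteristic polynomial `χ_A(t) = ∑_{X ∈ L(A)} μ(V, X) t ^ dim X`. -/
def charPoly {V : Type} [AddCommGroup V] [Module ℝ V] (A : Finset (Submodule ℝ V)) : ℚ[X] :=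
  ∑ Y : IntersectionPoset A,
    Polynomial.C (moebius A (wholeSpace A) Y : ℚ) *
      Polynomial.X ^ Module.finrank ℝ (OrderDual.ofDual Y : flats A).1

/-! ### The clan `𝒜(m)` -/

/-- The support of a subspace `H` of `ℝ^n`. If `H` is cut out by the equations
`a_{1j} x_1 + ⋯ + a_{nj} x_n = 0`, then `a_{ij}` is the value of the `j`-th form at the basis
vector `e_i`, so that some `a_{ij}` is nonzero if and only if `e_i ∉ H`. -/
def supp {n : ℕ} (H : Submodule ℝ (Fin n → ℝ)) : Set (Fin n) :=
  {i | (Pi.single i 1 : Fin n → ℝ) ∉ H}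

/-- Index set of the variables `x_{ir}`, `1 ≤ r ≤ m_i`. -/
abbrev ClanVar {n : ℕ} (m : Fin n →₀ ℕ) : Type := (i : Fin n) × Fin (m i)

/-- The tuples `k = (k_i)_{i ∈ supp m}` with `1 ≤ k_i ≤ m_i`. -/
abbrev ClanTuple {n : ℕ} (m : Fin n →₀ ℕ) : Type := (i : {i : Fin n // m i ≠ 0}) → Fin (m i)

/-- The subspace `x_{ir} - x_{is} = 0`. -/
def diagonal {n : ℕ} (m : Fin n →₀ ℕ) (i : Fin n) (r s : Fin (m i)) :
    Submodule ℝ (ClanVar m → ℝ) :=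
  LinearMap.ker ((LinearMap.proj ⟨i, r⟩ : (ClanVar m → ℝ) →ₗ[ℝ] ℝ) - LinearMap.proj ⟨i, s⟩)

/-- The linear map `x ↦ (x_{1 k_1}, …, x_{n k_n})`, with entry `0` where `m_i = 0`. -/
def pick {n : ℕ} (m : Fin n →₀ ℕ) (k : ClanTuple m) : (ClanVar m → ℝ) →ₗ[ℝ] (Fin n → ℝ) :=
  LinearMap.pi fun i =>
    if h : m i ≠ 0 then LinearMap.proj (⟨i, k ⟨i, h⟩⟩ : ClanVar m) else 0

open Classical in
/-- The arrangement `𝒜(m)` in `ℝ^{|m|}`: all subspaces `x_{ir} = x_{is}` with `r ≠ s`, and, for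
every `H ∈ 𝒜` with `supp H ⊆ supp m` and every tuple `k`, the subspace obtained from the
equations of `H` by writing `x_{i k_i}` for `x_i`. -/
def clan {n : ℕ} (A : Finset (Submodule ℝ (Fin n → ℝ))) (m : Fin n →₀ ℕ) :
    Finset (Submodule ℝ (ClanVar m → ℝ)) :=
  ((Finset.univ : Finset ((i : Fin n) × (Fin (m i) × Fin (m i)))).filter
      fun p => p.2.1 ≠ p.2.2).image (fun p => diagonal m p.1 p.2.1 p.2.2) ∪
    ((A.filter fun H => supp H ⊆ {i | m i ≠ 0}) ×ˢ (Finset.univ : Finset (ClanTuple m))).image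
      fun p => p.1.comap (pick m p.2)

/-! ### Multi-colorings and chromatic polynomials -/

/-- `E` gives, for every `H ∈ 𝒜`, finitely many linear equations with integer coefficients that
define `H`. -/
def IsIntegralEquations {n : ℕ} (A : Finset (Submodule ℝ (Fin n → ℝ)))
    (E : Submodule ℝ (Fin n → ℝ) → Finset (Fin n → ℤ)) : Prop :=
  ∀ H ∈ A, ∀ x : Fin n → ℝ, x ∈ H ↔ ∀ a ∈ E H, ∑ i, (a i : ℝ) * x i = 0

/-- `C = (C_1, …, C_n)` is a multi-coloring of `𝒜` associated to `m` with colors in the finite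
field `F`: each `C_i` is a set of `m_i` colors, and for no `H ∈ 𝒜` do the equations of `H`, read
in `F`, have a solution with `x_i ∈ C_i` for all `i` in the support of `H` (the other coordinates
do not occur in the equations). -/
def IsMultiColoring {n : ℕ} (A : Finset (Submodule ℝ (Fin n → ℝ)))
    (E : Submodule ℝ (Fin n → ℝ) → Finset (Fin n → ℤ)) (m : Fin n →₀ ℕ)
    (F : Type) [Field F] (C : Fin n → Finset F) : Prop :=
  (∀ i, (C i).card = m i) ∧
    ∀ H ∈ A, ¬ ∃ x : Fin n → F, (∀ i ∈ supp H, x i ∈ C i) ∧ ∀ a ∈ E H, ∑ i, (a i : F) * x i = 0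

/-- `P(q)` is the number of multi-colorings of `𝒜` associated to `m` over the field with `q`
elements, for all prime powers `q` of large characteristic. -/
def CountsMultiColorings {n : ℕ} (A : Finset (Submodule ℝ (Fin n → ℝ)))
    (E : Submodule ℝ (Fin n → ℝ) → Finset (Fin n → ℤ)) (m : Fin n →₀ ℕ) (P : ℚ[X]) : Prop :=
  ∃ N : ℕ, ∀ (F : Type) [Field F] [Finite F], N < ringChar F →
    P.eval (Nat.card F : ℚ) = Nat.card {C : Fin n → Finset F // IsMultiColoring A E m F C}

/-- `P` is the polynomial that counts the multi-colorings of `𝒜` associated to `m`. -/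
def IsChromaticPoly {n : ℕ} (A : Finset (Submodule ℝ (Fin n → ℝ))) (m : Fin n →₀ ℕ)
    (P : ℚ[X]) : Prop :=
  ∃ E, IsIntegralEquations A E ∧ CountsMultiColorings A E m P

open Classical in
/-- The chromatic polynomial `Π_m(t)` of `𝒜`: the polynomial counting multi-colorings. If `𝒜`
has no equations with integer coefficients, there is no reduction to finite fields to count over,
and `Π_m` is understood as `χ_{𝒜(m)} / m!`. -/
def chromaticPoly {n : ℕ} (A : Finset (Submodule ℝ (Fin n → ℝ))) (m : Fin n →₀ ℕ) : ℚ[X] :=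
  if h : ∃ P, IsChromaticPoly A m P then h.choose
  else Polynomial.C (∏ i, ((m i).factorial : ℚ))⁻¹ * charPoly (clan A m)

/-! ### The independence series -/

/-- The logarithm of a power series with constant term `1`. -/
def log {n : ℕ} (f : MvPowerSeries (Fin n) (RatFunc ℚ)) : MvPowerSeries (Fin n) (RatFunc ℚ) :=
  (PowerSeries.log (RatFunc ℚ)).subst (f - 1)

/-- The exponential of a power series with constant term `0`. -/
def exp {n : ℕ} (f : MvPowerSeries (Fin n) (RatFunc ℚ)) : MvPowerSeries (Fin n) (RatFunc ℚ) :=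
  (PowerSeries.exp (RatFunc ℚ)).subst f

/-- The power `f ^ c = exp (c log f)` of a power series with constant term `1`, for an arbitrary
scalar `c ∈ ℚ(t)`. -/
def power {n : ℕ} (f : MvPowerSeries (Fin n) (RatFunc ℚ)) (c : RatFunc ℚ) :
    MvPowerSeries (Fin n) (RatFunc ℚ) :=
  exp (c • log f)

/-- The independence series `I(𝒜, x) = (∑_m Π_m(t) x^m)^{1/t}`, a power series over `ℚ(t)`. -/
def independenceSeries {n : ℕ} (A : Finset (Submodule ℝ (Fin n → ℝ))) :
    MvPowerSeries (Fin n) (RatFunc ℚ) :=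
  power (fun m => algebraMap ℚ[X] (RatFunc ℚ) (chromaticPoly A m)) (RatFunc.X)⁻¹

/-- The series `I(𝒜, -x)`. -/
def independenceSeriesNeg {n : ℕ} (A : Finset (Submodule ℝ (Fin n → ℝ))) :
    MvPowerSeries (Fin n) (RatFunc ℚ) :=
  MvPowerSeries.rescale (fun _ => -1) (independenceSeries A)

/-- The specialization `t = c` of the coefficients of a power series over `ℚ(t)`. -/
def specialize {n : ℕ} (f : MvPowerSeries (Fin n) (RatFunc ℚ)) (c : ℚ) :
    MvPowerSeries (Fin n) ℚ :=
  fun m => RatFunc.eval (RingHom.id ℚ) c (MvPowerSeries.coeff m f)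

end SubspaceArrangement

end

noncomputable section

namespace SubspaceArrangement

/-! ### Logarithm and exponential of power series -/

section PowerSeries

variable {K : Type*} [Field K] [Algebra ℚ K]

/-! Everything rests on the identity `Π_m = χ_{A(m)} / m!` (`chromaticPoly_eq`), proved by the
finite field method. A point of `F^{|m|}` off the clan is a multi-coloring together with an ordering
of each color set, so the complement has `m!` points over every multi-coloring. Inclusion-exclusion
writes its size as `∑_T (-1)^|T| q^{dim}` over subfamilies `T` of the clan. In large characteristic
these dimensions agree with the real ones, and by Whitney's theorem the sum is `χ_{A(m)}(q)`. A
polynomial is determined by its values at large primes, so this is the polynomial chosen in the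
definition; without integral equations the identity is the definition.

Whitney's sum also gives the sign. With a subspace `U` to intersect with as a parameter, it
satisfies deletion-restriction. Each restriction to a hyperplane not containing `U` lowers `dim U`
by one, so `(-1)^{dim U}` times the value at `-q` is nonnegative by induction.

The rest is formal: `log` and `exp` are inverse under substitution, so raising to `1/t` and then to
`t` changes nothing. The sign change of `x` commutes with powers, and the resulting coefficients are
polynomials in `t`, which may be evaluated anywhere. -/

theorem one_add_X_mul_deriv_log :
    (1 + PowerSeries.X) * PowerSeries.derivative K (PowerSeries.log K) = 1 := by
  rw [PowerSeries.deriv_log]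
  ext n
  rw [add_mul, one_mul, map_add]
  cases n with
  | zero => simp
  | succ n =>
    rw [mul_comm, PowerSeries.coeff_succ_mul_X]
    simp [PowerSeries.coeff_one, pow_succ]

/-- Both sides have zero constant term and, by the chain rule and `(1 + X) log' = 1`, derivative
`1`. -/
theorem log_subst_exp_sub_one :
    (PowerSeries.log K).subst (PowerSeries.exp K - 1) = (PowerSeries.X : PowerSeries K) := by
  have : CharZero K := algebraRat.charZero K
  have hs := PowerSeries.HasSubst.exp_sub_one (A := K)
  apply PowerSeries.derivative.ext
  · rw [PowerSeries.derivative_subst hs, map_sub, PowerSeries.derivative_exp]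
    have h := congrArg (PowerSeries.subst (PowerSeries.exp K - 1)) (one_add_X_mul_deriv_log (K := K))
    have h1 : PowerSeries.subst (PowerSeries.exp K - 1) (1 : PowerSeries K) = 1 := by
      rw [← PowerSeries.coe_substAlgHom hs, map_one]
    rw [PowerSeries.subst_mul hs, PowerSeries.subst_add hs, PowerSeries.subst_X hs, h1] at h
    rw [add_sub_cancel] at h
    simpa [mul_comm] using h
  · rw [PowerSeries.constantCoeff_X]
    exact PowerSeries.constantCoeff_subst_eq_zero (by
      rw [← PowerSeries.constantCoeff_eq]; simp) _ (by simp)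

/-- A one-sided compositional inverse of a series with unit linear coefficient is two-sided: `exp -
1` must be the inverse series of `log`. -/
theorem exp_subst_log :
    (PowerSeries.exp K).subst (PowerSeries.log K) = (1 + PowerSeries.X : PowerSeries K) := by
  have hE := PowerSeries.HasSubst.exp_sub_one (A := K)
  have hL := PowerSeries.HasSubst.log (A := K)
  have hu : IsUnit ((PowerSeries.log K).coeff 1) := by simp
  have hI := PowerSeries.HasSubst.substInvOfIsUnit (P := PowerSeries.log K) (hP' := hu)
  have hl := PowerSeries.subst_substInvOfIsUnit_left (P := PowerSeries.log K) (hP' := hu)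
  have hE' : PowerSeries.exp K - 1 = (PowerSeries.log K).substInvOfIsUnit hu := by
    calc PowerSeries.exp K - 1
        = PowerSeries.subst (PowerSeries.exp K - 1) (PowerSeries.X : PowerSeries K) :=
          (PowerSeries.subst_X hE).symm
      _ = _ := by
        rw [← hl (by simp), PowerSeries.subst_comp_subst_apply hL hE, log_subst_exp_sub_one,
          PowerSeries.X_subst]
  have h := hl (by simp)
  rw [← hE', PowerSeries.subst_sub hL] at h
  have h1 : PowerSeries.subst (PowerSeries.log K) (1 : PowerSeries K) = 1 := by
    rw [← PowerSeries.coe_substAlgHom hL, map_one]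
  rw [h1] at h
  rw [← h]; ring

variable {σ : Type*}

theorem log_subst_exp_subst {f : MvPowerSeries σ K} (hf : f.constantCoeff = 0) :
    (PowerSeries.log K).subst ((PowerSeries.exp K).subst f - 1) = f := by
  have hf' := PowerSeries.HasSubst.of_constantCoeff_zero hf
  have h1 : PowerSeries.subst f (1 : PowerSeries K) = 1 := by
    rw [← PowerSeries.coe_substAlgHom hf', map_one]
  rw [← h1, ← PowerSeries.subst_sub hf', ← PowerSeries.subst_comp_subst_apply
    PowerSeries.HasSubst.exp_sub_one hf', log_subst_exp_sub_one, PowerSeries.subst_X hf']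

theorem exp_subst_log_subst {f : MvPowerSeries σ K} (hf : f.constantCoeff = 1) :
    (PowerSeries.exp K).subst ((PowerSeries.log K).subst (f - 1)) = f := by
  have hf' : PowerSeries.HasSubst (f - 1) :=
    PowerSeries.HasSubst.of_constantCoeff_zero (by simp [hf])
  have h1 : PowerSeries.subst (f - 1) (1 : PowerSeries K) = 1 := by
    rw [← PowerSeries.coe_substAlgHom hf', map_one]
  rw [← PowerSeries.subst_comp_subst_apply PowerSeries.HasSubst.log hf', exp_subst_log,
    PowerSeries.subst_add hf', h1, PowerSeries.subst_X hf', add_sub_cancel]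

-- Rescaling is itself a substitution, so this is associativity of substitution.
omit [Algebra ℚ K] in
theorem rescale_subst {n : ℕ} (a : Fin n → K) {f : MvPowerSeries (Fin n) K}
    (hf : f.constantCoeff = 0) (g : PowerSeries K) :
    MvPowerSeries.rescale a (g.subst f) = g.subst (MvPowerSeries.rescale a f) := by
  rw [MvPowerSeries.rescale_eq_subst, MvPowerSeries.rescale_eq_subst, PowerSeries.subst,
    PowerSeries.subst, MvPowerSeries.subst_comp_subst_apply]
  · exact PowerSeries.HasSubst.const (PowerSeries.HasSubst.of_constantCoeff_zero hf)
  · exact MvPowerSeries.hasSubst_of_constantCoeff_zero (by simp)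

end PowerSeries

variable {n : ℕ}

theorem constantCoeff_log {f : MvPowerSeries (Fin n) (RatFunc ℚ)} (hf : f.constantCoeff = 1) :
    (log f).constantCoeff = 0 :=
  PowerSeries.constantCoeff_subst_eq_zero (by simp [hf]) _ (by simp)

theorem power_power_of_mul_eq_one {f : MvPowerSeries (Fin n) (RatFunc ℚ)}
    (hf : f.constantCoeff = 1) {c d : RatFunc ℚ} (h : d * c = 1) :
    power (power f c) d = f := by
  have hl : log (power f c) = c • log f :=
    log_subst_exp_subst (by rw [MvPowerSeries.constantCoeff_smul, constantCoeff_log hf, smul_zero])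
  rw [power, hl, smul_smul, h, one_smul]
  exact exp_subst_log_subst hf

theorem rescale_power (a : Fin n → RatFunc ℚ) {f : MvPowerSeries (Fin n) (RatFunc ℚ)}
    (hf : f.constantCoeff = 1) (c : RatFunc ℚ) :
    MvPowerSeries.rescale a (power f c) = power (MvPowerSeries.rescale a f) c := by
  unfold power exp
  rw [rescale_subst _ (by rw [MvPowerSeries.constantCoeff_smul, constantCoeff_log hf, smul_zero])]
  congr 1
  have : MvPowerSeries.rescale a (log f) = log (MvPowerSeries.rescale a f) := by
    unfold log
    rw [rescale_subst _ (by simp [hf])]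
    simp
  rw [← this]
  ext m
  simp only [MvPowerSeries.coeff_rescale, MvPowerSeries.coeff_smul]
  ring

theorem constantCoeff_power {f : MvPowerSeries (Fin n) (RatFunc ℚ)}
    (hf : f.constantCoeff = 1) (c : RatFunc ℚ) : (power f c).constantCoeff = 1 := by
  have h0 : (c • log f).constantCoeff = 0 := by
    rw [MvPowerSeries.constantCoeff_smul, constantCoeff_log hf, smul_zero]
  have hs := PowerSeries.HasSubst.of_constantCoeff_zero h0
  have h1 : PowerSeries.subst (c • log f) (1 : PowerSeries (RatFunc ℚ)) = 1 := by
    rw [← PowerSeries.coe_substAlgHom hs, map_one]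
  have h := PowerSeries.constantCoeff_subst_eq_zero h0 (PowerSeries.exp (RatFunc ℚ) - 1) (by simp)
  rw [PowerSeries.subst_sub hs, h1, map_sub, map_one, sub_eq_zero] at h
  exact h

/-! ### Whitney's theorem and the signs of the coefficients -/

section Whitney

variable {V ι : Type} [AddCommGroup V] [Module ℝ V]

/-- The alternating sum `∑_T (-1)^|T| t^dim(U ∩ ⋂_{i ∈ T} f i)` over the subfamilies `T` of `s`. -/
def whitneyPoly (s : Finset ι) (f : ι → Submodule ℝ V) (U : Submodule ℝ V) : ℚ[X] :=
  ∑ T ∈ s.powerset, (-1) ^ T.card * Polynomial.X ^ Module.finrank ℝ ↥(U ⊓ T.inf f)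

open Classical in
theorem inf_mem_flats {s T : Finset ι} (f : ι → Submodule ℝ V) (hT : T ⊆ s) :
    T.inf f ∈ flats (s.image f) :=
  Finset.mem_image.mpr ⟨T.image f, Finset.mem_powerset.mpr (Finset.image_subset_image hT), by
    rw [Finset.inf_image]; rfl⟩

-- A flat other than `V` is the intersection of a nonempty subfamily and so lies in a member.
open Classical in
theorem le_of_mem_flats {s : Finset ι} {f : ι → Submodule ℝ V} {Y : Submodule ℝ V}
    (hY : Y ∈ flats (s.image f)) (h : ∀ i ∈ s, ¬ Y ≤ f i) : Y = ⊤ := by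
  obtain ⟨B, hB, rfl⟩ := Finset.mem_image.mp hY
  rw [Finset.mem_powerset] at hB
  obtain rfl | ⟨H, hH⟩ := B.eq_empty_or_nonempty
  · simp
  · obtain ⟨i, hi, rfl⟩ := Finset.mem_image.mp (hB hH)
    exact absurd (Finset.inf_le (f := id) hH) (h i hi)

-- The subfamilies in question are all the subsets of `{i | Y ≤ f i}`, so the alternating sum
-- vanishes unless that set is empty, which happens only for `Y = V`.
open Classical in
theorem sum_powerset_filter_le {s : Finset ι} {f : ι → Submodule ℝ V} (hf : ∀ i ∈ s, f i ≠ ⊤)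
    {Y : Submodule ℝ V} (hY : Y ∈ flats (s.image f)) :
    ∑ T ∈ s.powerset with Y ≤ T.inf f, (-1 : ℤ) ^ T.card = if Y = ⊤ then 1 else 0 := by
  have h : s.powerset.filter (fun T => Y ≤ T.inf f) = (s.filter fun i => Y ≤ f i).powerset := by
    ext T
    simp only [Finset.mem_filter, Finset.mem_powerset, Finset.le_inf_iff, Finset.subset_iff]
    exact ⟨fun h i hi => ⟨h.1 hi, h.2 i hi⟩, fun h => ⟨fun i hi => (h hi).1, fun i hi => (h hi).2⟩⟩
  rw [h, Finset.sum_powerset_neg_one_pow_card]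
  refine if_congr ?_ rfl rfl
  rw [Finset.filter_eq_empty_iff]
  refine ⟨le_of_mem_flats hY, ?_⟩
  rintro rfl i hi
  simpa using hf i hi

-- The right-hand side satisfies the recursion that determines `μ(V, ·)`: its sum over `[V, Y]` is
-- `1` if `Y = V` and `0` otherwise. The family may repeat subspaces, as the clan's indexing does.
open Classical in
theorem moebius_image {s : Finset ι} {f : ι → Submodule ℝ V} (hf : ∀ i ∈ s, f i ≠ ⊤)
    (Y : IntersectionPoset (s.image f)) :
    moebius (s.image f) (wholeSpace _) Y =
      ∑ T ∈ s.powerset with T.inf f = (OrderDual.ofDual Y).1, (-1) ^ T.card := by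
  let : LocallyFiniteOrder (IntersectionPoset (s.image f)) := Fintype.toLocallyFiniteOrder
  change IncidenceAlgebra.mu ℤ (wholeSpace _) Y = _
  have hle : ∀ Z : IntersectionPoset (s.image f), wholeSpace _ ≤ Z := fun Z =>
    show (OrderDual.ofDual Z).1 ≤ ⊤ from le_top
  set w : IntersectionPoset (s.image f) → ℤ := fun Y =>
    ∑ T ∈ s.powerset with T.inf f = (OrderDual.ofDual Y).1, (-1) ^ T.card with hw
  have hsum : ∀ Z : IntersectionPoset (s.image f),
      ∑ x ∈ Finset.Icc (wholeSpace _) Z, w x = if wholeSpace _ = Z then 1 else 0 := by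
    intro Z
    have h1 := sum_powerset_filter_le hf (OrderDual.ofDual Z).2
    have h2 : (wholeSpace _ = Z) ↔ ((OrderDual.ofDual Z).1 = ⊤) := by
      rw [← OrderDual.ofDual_inj, Subtype.ext_iff, eq_comm]; rfl
    rw [if_congr h2 rfl rfl, ← h1]
    simp only [hw]
    rw [Finset.sum_sigma']
    refine Finset.sum_bij (fun a _ => a.2) ?_ ?_ ?_ ?_
    · rintro ⟨x, T⟩ h
      simp only [Finset.mem_sigma, Finset.mem_Icc, Finset.mem_filter] at h
      rw [Finset.mem_filter]
      exact ⟨h.2.1, h.2.2 ▸ h.1.2⟩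
    · rintro ⟨x, T⟩ h ⟨x', T'⟩ h' (rfl : T = T')
      simp only [Finset.mem_sigma, Finset.mem_Icc, Finset.mem_filter] at h h'
      have : x = x' := OrderDual.ofDual_inj.mp (Subtype.ext (h.2.2.symm.trans h'.2.2))
      rw [this]
    · intro T hT
      rw [Finset.mem_filter] at hT
      refine ⟨⟨OrderDual.toDual ⟨T.inf f, inf_mem_flats f (Finset.mem_powerset.mp hT.1)⟩, T⟩, ?_,
        rfl⟩
      simp only [Finset.mem_sigma, Finset.mem_Icc, Finset.mem_filter]
      exact ⟨⟨hle _, hT.2⟩, hT.1, rfl⟩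
    · intro a _; rfl
  change _ = w Y
  -- Both functions have equal sums over `[V, Y]` and agree strictly below `Y`, so cancellation
  -- leaves the value at `Y`.
  induction Y using WellFoundedLT.induction with
  | ind Y ih =>
    have h := (IncidenceAlgebra.sum_Icc_mu_right (𝕜 := ℤ) (wholeSpace _) Y).trans (hsum Y).symm
    rw [← Finset.Ico_insert_right (hle Y), Finset.sum_insert Finset.right_notMem_Ico,
      Finset.sum_insert Finset.right_notMem_Ico,
      Finset.sum_congr rfl fun x hx => ih x (Finset.mem_Ico.mp hx).2] at h
    exact add_right_cancel h

open Classical in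
/-- **Whitney's theorem**: the characteristic polynomial as an alternating sum over subfamilies. -/
theorem charPoly_image {s : Finset ι} {f : ι → Submodule ℝ V} (hf : ∀ i ∈ s, f i ≠ ⊤) :
    charPoly (s.image f) = whitneyPoly s f ⊤ := by
  unfold charPoly whitneyPoly
  simp_rw [moebius_image hf]
  push_cast
  simp_rw [map_sum, Finset.sum_mul]
  rw [Finset.sum_sigma']
  refine Finset.sum_bij (fun a _ => a.2) ?_ ?_ ?_ ?_
  · rintro ⟨x, T⟩ h
    simp only [Finset.mem_sigma, Finset.mem_filter] at h
    exact h.2.1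
  · rintro ⟨x, T⟩ h ⟨x', T'⟩ h' (rfl : T = T')
    simp only [Finset.mem_sigma, Finset.mem_filter] at h h'
    have : x = x' := OrderDual.ofDual_inj.mp (Subtype.ext (h.2.2.symm.trans h'.2.2))
    rw [this]
  · intro T hT
    refine ⟨⟨OrderDual.toDual ⟨T.inf f, inf_mem_flats f (Finset.mem_powerset.mp hT)⟩, T⟩, ?_, rfl⟩
    simp only [Finset.mem_sigma, Finset.mem_univ, Finset.mem_filter]
    exact ⟨trivial, hT, rfl⟩
  · rintro ⟨x, T⟩ h
    simp only [Finset.mem_sigma, Finset.mem_filter] at h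
    rw [top_inf_eq, h.2.2]
    simp

/-- Deletion-restriction: in the subfamilies containing `i`, the factor `f i` is absorbed into `U`,
which keeps the restriction inside the same ambient space. -/
theorem whitneyPoly_insert [DecidableEq ι] {s : Finset ι} {i : ι} (hi : i ∉ s)
    (f : ι → Submodule ℝ V) (U : Submodule ℝ V) :
    whitneyPoly (insert i s) f U = whitneyPoly s f U - whitneyPoly s f (U ⊓ f i) := by
  unfold whitneyPoly
  rw [Finset.sum_powerset_insert hi, sub_eq_add_neg, ← Finset.sum_neg_distrib]
  congr 1
  refine Finset.sum_congr rfl fun T hT => ?_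
  have hiT : i ∉ T := fun h => hi (Finset.mem_powerset.mp hT h)
  rw [Finset.card_insert_of_notMem hiT, Finset.inf_insert, ← inf_assoc, pow_succ]
  ring

theorem finrank_inf_add_one [FiniteDimensional ℝ V] {U H : Submodule ℝ V}
    (hH : Module.finrank ℝ H + 1 = Module.finrank ℝ V) (hU : ¬ U ≤ H) :
    Module.finrank ℝ ↥(U ⊓ H) + 1 = Module.finrank ℝ U := by
  have h1 := Submodule.finrank_sup_add_finrank_inf_eq U H
  have h2 : Module.finrank ℝ H < Module.finrank ℝ ↥(U ⊔ H) :=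
    Submodule.finrank_lt_finrank_of_lt (lt_of_le_of_ne le_sup_right fun h =>
      hU (h ▸ le_sup_left))
  have h3 := Submodule.finrank_le (U ⊔ H)
  omega

theorem whitneyPoly_eval_neg_nonneg [FiniteDimensional ℝ V] {s : Finset ι}
    {f : ι → Submodule ℝ V}
    (hf : ∀ i ∈ s, Module.finrank ℝ (f i) + 1 = Module.finrank ℝ V) (q : ℕ)
    (U : Submodule ℝ V) :
    0 ≤ (-1) ^ Module.finrank ℝ U * (whitneyPoly s f U).eval (-(q : ℚ)) := by
  classical
  induction s using Finset.induction_on generalizing U with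
  | empty =>
    simp only [whitneyPoly, Finset.powerset_empty, Finset.sum_singleton, Finset.card_empty,
      pow_zero, one_mul, Polynomial.eval_pow, Polynomial.eval_X]
    rw [Finset.inf_empty, inf_top_eq, ← mul_pow]
    simp
  | insert i s hi ih =>
    have ih' := ih fun j hj => hf j (Finset.mem_insert_of_mem hj)
    rw [whitneyPoly_insert hi, Polynomial.eval_sub]
    -- If `U ≤ f i`, deletion and restriction cancel. Otherwise the dimension drops by one, which
    -- turns the minus sign into a plus.
    by_cases hU : U ≤ f i
    · rw [inf_eq_left.mpr hU, sub_self, mul_zero]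
    · have h := finrank_inf_add_one (hf i (Finset.mem_insert_self i s)) hU
      have h1 := ih' U
      have h2 := ih' (U ⊓ f i)
      rw [← h, pow_succ] at h1 ⊢
      linarith

end Whitney

/-! ### Integral equations over fields of large characteristic -/

section Reduction

variable {V : Type} [Fintype V]

/-- The solutions in `F^V` of a set of linear equations with integer coefficients. -/
def solutions (F : Type) [Field F] (M : Finset (V → ℤ)) : Submodule F (V → F) where
  carrier := {x | ∀ a ∈ M, ∑ v, (a v : F) * x v = 0}
  add_mem' {x y} hx hy a ha := by
    simp [mul_add, Finset.sum_add_distrib, hx a ha, hy a ha]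
  zero_mem' a _ := by simp
  smul_mem' c x hx a ha := by
    simp [mul_left_comm _ c, ← Finset.mul_sum, hx a ha]

theorem mem_solutions {F : Type} [Field F] {M : Finset (V → ℤ)} {x : V → F} :
    x ∈ solutions F M ↔ ∀ a ∈ M, ∑ v, (a v : F) * x v = 0 :=
  Iff.rfl

theorem exists_int_mul {ι : Type*} [Finite ι] (g : ι → ℚ) :
    ∃ d : ℤ, d ≠ 0 ∧ ∃ z : ι → ℤ, ∀ i, (z i : ℚ) = d * g i := by
  obtain ⟨b, hb⟩ := IsLocalization.exist_integer_multiples_of_finite (nonZeroDivisors ℤ) g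
  choose z hz using hb
  refine ⟨b, nonZeroDivisors.coe_ne_zero b, z, fun i => ?_⟩
  have := hz i
  rw [Algebra.smul_def] at this
  simpa using this

/-- A maximal independent subset of a system of integral equations, with a common denominator `D`
for the coefficients of the other equations and for a right inverse. -/
theorem exists_integral_basis (M : Finset (V → ℤ)) :
    ∃ (D : ℤ) (_ : D ≠ 0) (κ : Type) (_ : Fintype κ) (_ : DecidableEq κ) (b : κ → V → ℤ)
      (G : V → κ → ℤ), (∀ j, b j ∈ M) ∧
      (∀ a ∈ M, ∃ c : κ → ℤ, ∀ v, D * a v = ∑ j, c j * b j v) ∧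
      ∀ i j, ∑ v, b i v * G v j = if i = j then D else 0 := by
  classical
  let r : M → V → ℚ := fun a v => (a.1 v : ℚ)
  obtain ⟨κ, a, ha, hspan, hli⟩ := exists_linearIndependent' ℚ r
  have : Finite κ := Finite.of_injective a ha
  have : Fintype κ := Fintype.ofFinite κ
  have hc : ∀ μ : M, ∃ c : κ → ℚ, ∑ j, c j • (r ∘ a) j = r μ := fun μ => by
    rw [← Submodule.mem_span_range_iff_exists_fun, hspan]
    exact Submodule.subset_span ⟨μ, rfl⟩
  choose c hc using hc
  -- The values of `g` at the unit vectors are the entries of a right inverse of the matrix with the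
  -- independent rows `r (a i)`.
  obtain ⟨g, hg⟩ := LinearMap.exists_leftInverse_of_injective (Fintype.linearCombination ℚ (r ∘ a))
    (LinearMap.ker_eq_bot.mpr hli.fintypeLinearCombination_injective)
  have hg' : ∀ i j, ∑ v, (r (a i) v) * g (Pi.single v 1) j = if i = j then 1 else 0 := by
    intro i j
    have h := congrFun (LinearMap.congr_fun hg (Pi.single i 1)) j
    rw [LinearMap.comp_apply, Fintype.linearCombination_apply_single, one_smul] at h
    have h2 : (r ∘ a) i = ∑ v, r (a i) v • (Pi.single v 1 : V → ℚ) := by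
      simpa using pi_eq_sum_univ' (r (a i))
    rw [h2, map_sum, Finset.sum_apply] at h
    simp only [map_smul, Pi.smul_apply, smul_eq_mul] at h
    rw [h]
    simp [Pi.single_apply, eq_comm]
  obtain ⟨d₁, hd₁, z₁, hz₁⟩ := exists_int_mul fun p : M × κ => c p.1 p.2
  obtain ⟨d₂, hd₂, z₂, hz₂⟩ := exists_int_mul fun p : V × κ => g (Pi.single p.1 1) p.2
  -- Each set of coefficients is multiplied by the other's denominator, so that a single `D = d₁ *
  -- d₂` serves both.
  refine ⟨d₁ * d₂, mul_ne_zero hd₁ hd₂, κ, inferInstance, inferInstance, fun j => (a j).1,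
    fun v j => d₁ * z₂ (v, j), fun j => (a j).2, fun μ hμ => ⟨fun j => d₂ * z₁ (⟨μ, hμ⟩, j), ?_⟩, ?_⟩
  · intro v
    have h := congrFun (hc ⟨μ, hμ⟩) v
    simp only [Finset.sum_apply, Pi.smul_apply, smul_eq_mul, Function.comp_apply, r] at h
    have : ((d₁ * d₂ * μ v : ℤ) : ℚ) = ((∑ j, d₂ * z₁ (⟨μ, hμ⟩, j) * (a j).1 v : ℤ) : ℚ) := by
      push_cast
      rw [← h, Finset.mul_sum]
      refine Finset.sum_congr rfl fun j _ => ?_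
      rw [hz₁]; ring
    exact_mod_cast this
  · intro i j
    have h := hg' i j
    have : ((∑ v, (a i).1 v * (d₁ * z₂ (v, j)) : ℤ) : ℚ) = d₁ * d₂ * if i = j then 1 else 0 := by
      push_cast
      rw [← h, Finset.mul_sum]
      refine Finset.sum_congr rfl fun v _ => ?_
      rw [hz₂]; simp only [r]; ring
    split_ifs at this ⊢ with hij
    · rw [mul_one] at this; exact_mod_cast this
    · rw [mul_zero] at this; exact_mod_cast this

/-- The solution space of a system of integral equations has the same dimension over every field
in which a certain nonzero integer does not vanish. -/
theorem exists_finrank_solutions (M : Finset (V → ℤ)) :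
    ∃ D : ℤ, D ≠ 0 ∧ ∃ r : ℕ, ∀ (F : Type) [Field F], (D : F) ≠ 0 →
      Module.finrank F (solutions F M) + r = Fintype.card V := by
  obtain ⟨D, hD, κ, _, _, b, G, hb, hc, hG⟩ := exists_integral_basis M
  refine ⟨D, hD, Fintype.card κ, fun F _ hF => ?_⟩
  let φ : (V → F) →ₗ[F] (κ → F) :=
    Matrix.mulVecLin (Matrix.of fun j v => (b j v : F))
  have hφ : ∀ x j, φ x j = ∑ v, (b j v : F) * x v := fun x j => rfl
  -- Since `D` is invertible in `F`, the basis equations imply all the others.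
  have hker : LinearMap.ker φ = solutions F M := by
    ext x
    rw [LinearMap.mem_ker, mem_solutions]
    constructor
    · intro h a ha
      obtain ⟨c, hc⟩ := hc a ha
      have h1 : (D : F) * ∑ v, (a v : F) * x v = ∑ j, (c j : F) * φ x j := by
        simp_rw [hφ, Finset.mul_sum]
        rw [Finset.sum_comm]
        refine Finset.sum_congr rfl fun v _ => ?_
        have := congrArg (Int.cast : ℤ → F) (hc v)
        push_cast at this
        rw [← mul_assoc, this, Finset.sum_mul]
        exact Finset.sum_congr rfl fun j _ => by ring
      rw [h] at h1
      simpa [hF] using h1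
    · intro h
      ext j
      rw [hφ]
      exact h _ (hb j)
  -- `D⁻¹ G` is a right inverse, so the rank is the size of `κ` over every such field.
  have hsurj : LinearMap.range φ = ⊤ := by
    rw [LinearMap.range_eq_top]
    intro y
    refine ⟨fun v => ∑ j, (G v j : F) * ((D : F)⁻¹ * y j), ?_⟩
    ext i
    rw [hφ]
    simp_rw [Finset.mul_sum]
    rw [Finset.sum_comm]
    have : ∀ j, ∑ v, (b i v : F) * ((G v j : F) * ((D : F)⁻¹ * y j)) = if i = j then y j else 0 := by
      intro j
      have h := congrArg (Int.cast : ℤ → F) (hG i j)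
      push_cast at h
      simp_rw [← mul_assoc]
      rw [← Finset.sum_mul, ← Finset.sum_mul, h]
      split_ifs
      · rw [mul_inv_cancel₀ hF, one_mul]
      · ring
    simp [this]
  have h := LinearMap.finrank_range_add_finrank_ker φ
  rw [hker, hsurj, finrank_top, Module.finrank_fintype_fun_eq_card,
    Module.finrank_fintype_fun_eq_card] at h
  omega

theorem intCast_ne_zero_of_natAbs_lt_ringChar {F : Type} [Field F] {D : ℤ} (hD : D ≠ 0)
    (h : D.natAbs < ringChar F) : (D : F) ≠ 0 := by
  rw [Ne, CharP.intCast_eq_zero_iff F (ringChar F)]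
  intro hdvd
  have := Nat.le_of_dvd (Int.natAbs_pos.mpr hD) (Int.natCast_dvd.mp hdvd)
  omega

theorem exists_card_solutions (M : Finset (V → ℤ)) :
    ∃ N : ℕ, ∀ (F : Type) [Field F] [Finite F], N < ringChar F →
      Nat.card (solutions F M) = Nat.card F ^ Module.finrank ℝ (solutions ℝ M) := by
  obtain ⟨D, hD, r, h⟩ := exists_finrank_solutions M
  refine ⟨D.natAbs, fun F _ _ hF => ?_⟩
  have h1 := h F (intCast_ne_zero_of_natAbs_lt_ringChar hD hF)
  have h2 := h ℝ (by exact_mod_cast hD)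
  rw [Module.natCard_eq_pow_finrank (K := F)]
  congr 1
  omega

theorem inf_solutions {ι : Type} [DecidableEq (V → ℤ)] (F : Type) [Field F] (T : Finset ι)
    (e : ι → Finset (V → ℤ)) : T.inf (fun i => solutions F (e i)) = solutions F (T.biUnion e) := by
  ext x
  simp only [Submodule.mem_finsetInf, mem_solutions, Finset.mem_biUnion]
  exact ⟨fun h a ⟨i, hi, ha⟩ => h i hi a ha, fun h i hi a ha => h a ⟨i, hi, ha⟩⟩

/-- The finite field method. -/
theorem exists_card_complement {ι : Type} (s : Finset ι) (e : ι → Finset (V → ℤ)) :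
    ∃ N : ℕ, ∀ (F : Type) [Field F] [Finite F], N < ringChar F →
      (whitneyPoly s (fun i => solutions ℝ (e i)) ⊤).eval (Nat.card F : ℚ) =
        Nat.card {x : V → F // ∀ i ∈ s, x ∉ solutions F (e i)} := by
  classical
  choose N hN using fun T : Finset ι => exists_card_solutions (T.biUnion e)
  refine ⟨s.powerset.sup N, fun F _ _ hF => ?_⟩
  have : Fintype F := Fintype.ofFinite F
  have h := Finset.inclusion_exclusion_card_inf_compl s
    fun i => (Finset.univ.filter fun x : V → F => x ∈ solutions F (e i))
  have h0 : ∀ T : Finset ι, T.inf (fun i => Finset.univ.filter fun x : V → F =>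
      x ∈ solutions F (e i)) =
      Finset.univ.filter fun x : V → F => x ∈ solutions F (T.biUnion e) := by
    intro T
    ext x
    rw [← inf_solutions]
    simp [Finset.mem_inf, Submodule.mem_finsetInf]
  have h1 : Nat.card {x : V → F // ∀ i ∈ s, x ∉ solutions F (e i)} =
      (s.inf fun i => (Finset.univ.filter fun x : V → F => x ∈ solutions F (e i))ᶜ).card := by
    rw [Nat.card_eq_fintype_card, Fintype.card_subtype]
    congr 1
    ext x
    simp [Finset.mem_inf]
  have h' := congrArg (Int.cast : ℤ → ℚ) h
  push_cast at h'
  rw [h1, h', whitneyPoly, Polynomial.eval_finsetSum]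
  refine Finset.sum_congr rfl fun T hT => ?_
  have h2 := hN T F ((Finset.le_sup hT).trans_lt hF)
  rw [h0, ← Fintype.card_subtype, ← Nat.card_eq_fintype_card]
  have h3 : Nat.card {x // x ∈ solutions F (T.biUnion e)} = _ := h2
  rw [h3, top_inf_eq, inf_solutions]
  simp

end Reduction

/-! ### The clan as an indexed family of hyperplanes -/

section Clan

variable {n : ℕ}

theorem exists_eq_ker {H : Submodule ℝ (Fin n → ℝ)} (hH : Module.finrank ℝ H + 1 = n) :
    ∃ φ : (Fin n → ℝ) →ₗ[ℝ] ℝ, H = LinearMap.ker φ := by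
  have hlt : H < ⊤ := lt_top_iff_ne_top.mpr fun h => by
    rw [h, finrank_top, Module.finrank_fin_fun] at hH
    omega
  obtain ⟨φ, hφ, hle⟩ := Submodule.exists_le_ker_of_lt_top H hlt
  refine ⟨φ, Submodule.eq_of_le_of_finrank_eq hle ?_⟩
  have := Module.Dual.finrank_ker_add_one_of_ne_zero hφ
  rw [Module.finrank_fin_fun] at this
  omega

theorem supp_nonempty {H : Submodule ℝ (Fin n → ℝ)} (hH : Module.finrank ℝ H + 1 = n) :
    (supp H).Nonempty := by
  by_contra h
  have hmem : ∀ i, (Pi.single i 1 : Fin n → ℝ) ∈ H := by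
    intro i
    by_contra hi
    exact h ⟨i, hi⟩
  have htop : H = ⊤ := by
    rw [eq_top_iff]
    intro x _
    rw [pi_eq_sum_univ' x]
    exact H.sum_mem fun i _ => H.smul_mem _ (by simpa using hmem i)
  rw [htop, finrank_top, Module.finrank_fin_fun] at hH
  omega

/-- The indices of the members of the clan: triples `(i, r, s)` for the hyperplanes
`x_{ir} = x_{is}`, and pairs of a member of `A` and a tuple. -/
abbrev ClanIndex (m : Fin n →₀ ℕ) : Type :=
  ((i : Fin n) × (Fin (m i) × Fin (m i))) ⊕ (Submodule ℝ (Fin n → ℝ) × ClanTuple m)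

open Classical in
/-- The indices that occur in the clan of `A`. -/
def clanIndices (A : Finset (Submodule ℝ (Fin n → ℝ))) (m : Fin n →₀ ℕ) :
    Finset (ClanIndex m) :=
  (Finset.univ.filter fun p => p.2.1 ≠ p.2.2).disjSum
    ((A.filter fun H => supp H ⊆ {i | m i ≠ 0}) ×ˢ Finset.univ)

/-- The member of the clan with a given index. -/
def clanMember (m : Fin n →₀ ℕ) : ClanIndex m → Submodule ℝ (ClanVar m → ℝ) :=
  Sum.elim (fun p => diagonal m p.1 p.2.1 p.2.2) fun p => p.1.comap (pick m p.2)

open Classical in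
theorem clan_eq_image (A : Finset (Submodule ℝ (Fin n → ℝ))) (m : Fin n →₀ ℕ) :
    clan A m = (clanIndices A m).image (clanMember m) := by
  ext X
  simp only [clan, clanIndices, Finset.mem_union, Finset.mem_image, Finset.mem_disjSum]
  constructor
  · rintro (⟨p, hp, rfl⟩ | ⟨p, hp, rfl⟩)
    · exact ⟨Sum.inl p, Or.inl ⟨p, hp, rfl⟩, rfl⟩
    · exact ⟨Sum.inr p, Or.inr ⟨p, hp, rfl⟩, rfl⟩
  · rintro ⟨_, ⟨p, hp, rfl⟩ | ⟨p, hp, rfl⟩, rfl⟩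
    · exact Or.inl ⟨p, hp, rfl⟩
    · exact Or.inr ⟨p, hp, rfl⟩

theorem inl_mem_clanIndices {A : Finset (Submodule ℝ (Fin n → ℝ))} {m : Fin n →₀ ℕ}
    {p : (i : Fin n) × (Fin (m i) × Fin (m i))} :
    Sum.inl p ∈ clanIndices A m ↔ p.2.1 ≠ p.2.2 := by
  simp [clanIndices]

theorem inr_mem_clanIndices {A : Finset (Submodule ℝ (Fin n → ℝ))} {m : Fin n →₀ ℕ}
    {p : Submodule ℝ (Fin n → ℝ) × ClanTuple m} :
    Sum.inr p ∈ clanIndices A m ↔ p.1 ∈ A ∧ supp p.1 ⊆ {i | m i ≠ 0} := by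
  simp [clanIndices]

theorem pick_single (m : Fin n →₀ ℕ) (k : ClanTuple m) {i : Fin n} (hi : m i ≠ 0) :
    pick m k (Pi.single ⟨i, k ⟨i, hi⟩⟩ 1) = Pi.single i 1 := by
  ext j
  simp only [pick, LinearMap.pi_apply]
  by_cases hij : j = i
  · subst hij
    simp [hi]
  · split_ifs with hj
    · rw [LinearMap.proj_apply, Pi.single_eq_of_ne hij, Pi.single_eq_of_ne]
      exact fun h => hij (congrArg Sigma.fst h)
    · simp [Pi.single_eq_of_ne hij]

theorem finrank_clanMember {A : Finset (Submodule ℝ (Fin n → ℝ))}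
    (hA : IsHyperplaneArrangement A) (m : Fin n →₀ ℕ) {j : ClanIndex m}
    (hj : j ∈ clanIndices A m) :
    Module.finrank ℝ (clanMember m j) + 1 = Module.finrank ℝ (ClanVar m → ℝ) := by
  rcases j with ⟨i, r, s⟩ | ⟨H, k⟩
  · have hrs : r ≠ s := inl_mem_clanIndices.mp hj
    refine Module.Dual.finrank_ker_add_one_of_ne_zero fun h => ?_
    have := LinearMap.congr_fun h (Pi.single (⟨i, r⟩ : ClanVar m) 1)
    simp [hrs.symm] at this
  · obtain ⟨hH, hsupp⟩ := inr_mem_clanIndices.mp hj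
    obtain ⟨φ, rfl⟩ := exists_eq_ker (hA H hH)
    obtain ⟨i, hi⟩ := supp_nonempty (hA _ hH)
    change Module.finrank ℝ (LinearMap.ker (φ ∘ₗ pick m k)) + 1 = _
    -- For `i ∈ supp H`, the basis vector of `x_{i k_i}` is sent to `e_i`, which is not in `H`; so
    -- the pulled-back form is nonzero.
    refine Module.Dual.finrank_ker_add_one_of_ne_zero fun h => hi ?_
    have := LinearMap.congr_fun h (Pi.single ⟨i, k ⟨i, hsupp hi⟩⟩ 1)
    rw [LinearMap.comp_apply, pick_single] at this
    exact this

theorem charPoly_clan {A : Finset (Submodule ℝ (Fin n → ℝ))}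
    (hA : IsHyperplaneArrangement A) (m : Fin n →₀ ℕ) :
    charPoly (clan A m) = whitneyPoly (clanIndices A m) (clanMember m) ⊤ := by
  classical
  rw [clan_eq_image, charPoly_image]
  intro j hj h
  have := finrank_clanMember hA m hj
  rw [h, finrank_top] at this
  omega

theorem finrank_clanVar (m : Fin n →₀ ℕ) : Module.finrank ℝ (ClanVar m → ℝ) = m.degree := by
  rw [Module.finrank_fintype_fun_eq_card, Fintype.card_sigma, Finsupp.degree_eq_sum]
  simp

theorem charPoly_clan_eval_neg_nonneg {A : Finset (Submodule ℝ (Fin n → ℝ))}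
    (hA : IsHyperplaneArrangement A) (m : Fin n →₀ ℕ) (q : ℕ) :
    0 ≤ (-1) ^ m.degree * (charPoly (clan A m)).eval (-(q : ℚ)) := by
  have h := whitneyPoly_eval_neg_nonneg (fun j hj => finrank_clanMember hA m hj) q ⊤
  rwa [finrank_top, finrank_clanVar, ← charPoly_clan hA] at h

/-- Every hyperplane has nonempty support, so the clan is empty. This gives the series the constant
term `1` that its logarithm needs. -/
theorem charPoly_clan_zero {A : Finset (Submodule ℝ (Fin n → ℝ))}
    (hA : IsHyperplaneArrangement A) : charPoly (clan A 0) = 1 := by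
  have h : clanIndices A 0 = ∅ := by
    rw [Finset.eq_empty_iff_forall_notMem]
    rintro (⟨i, r, s⟩ | ⟨H, k⟩) hj
    · exact r.elim0
    · obtain ⟨hH, hsupp⟩ := inr_mem_clanIndices.mp hj
      obtain ⟨i, hi⟩ := supp_nonempty (hA H hH)
      exact hsupp hi rfl
  have h2 : Module.finrank ℝ ↥((⊤ : Submodule ℝ (ClanVar (0 : Fin n →₀ ℕ) → ℝ)) ⊓
      (∅ : Finset (ClanIndex (0 : Fin n →₀ ℕ))).inf (clanMember 0)) = 0 := by
    rw [Finset.inf_empty, inf_top_eq, finrank_top, finrank_clanVar]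
    simp
  rw [charPoly_clan hA, h, whitneyPoly, Finset.powerset_empty, Finset.sum_singleton, h2]
  simp

end Clan

/-! ### Multi-colorings as points of the complement of the clan -/

section Colorings

variable {n : ℕ} {A : Finset (Submodule ℝ (Fin n → ℝ))}
  {E : Submodule ℝ (Fin n → ℝ) → Finset (Fin n → ℤ)} {m : Fin n →₀ ℕ}

/-- The point `(x_{1 k_1}, …, x_{n k_n})`, with entry `0` where `m_i = 0`. -/
def pickPoint {F : Type} [Field F] (k : ClanTuple m) (x : ClanVar m → F) (i : Fin n) : F :=
  if h : m i ≠ 0 then x ⟨i, k ⟨i, h⟩⟩ else 0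

/-- The linear form in the variables `x_{ir}` that arises from `a` by writing `x_{i k_i}` for
`x_i`. -/
def pullForm (k : ClanTuple m) (a : Fin n → ℤ) (v : ClanVar m) : ℤ :=
  if k ⟨v.1, fun h => (h ▸ v.2 : Fin 0).elim0⟩ = v.2 then a v.1 else 0

theorem sum_pullForm {F : Type} [Field F] (k : ClanTuple m) (a : Fin n → ℤ) (x : ClanVar m → F) :
    ∑ v, (pullForm k a v : F) * x v = ∑ i, (a i : F) * pickPoint k x i := by
  rw [Fintype.sum_sigma]
  refine Finset.sum_congr rfl fun i _ => ?_
  unfold pickPoint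
  split_ifs with h
  · rw [Finset.sum_eq_single (k ⟨i, h⟩)]
    · simp [pullForm]
    · intro r _ hr
      simp [pullForm, hr.symm]
    · simp
  · rw [mul_zero]
    refine Finset.sum_eq_zero fun r _ => ?_
    exact absurd (fun h0 : m i = 0 => (h0 ▸ r : Fin 0).elim0) h

open Classical in
/-- Integral equations for the members of the clan. -/
def clanEquations (E : Submodule ℝ (Fin n → ℝ) → Finset (Fin n → ℤ)) (m : Fin n →₀ ℕ) :
    ClanIndex m → Finset (ClanVar m → ℤ) :=
  Sum.elim (fun p => {Pi.single ⟨p.1, p.2.1⟩ 1 - Pi.single ⟨p.1, p.2.2⟩ 1})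
    fun p => (E p.1).image (pullForm p.2)

theorem mem_solutions_inl {F : Type} [Field F] {p : (i : Fin n) × (Fin (m i) × Fin (m i))}
    {x : ClanVar m → F} :
    x ∈ solutions F (clanEquations E m (Sum.inl p)) ↔ x ⟨p.1, p.2.1⟩ = x ⟨p.1, p.2.2⟩ := by
  simp [mem_solutions, clanEquations, sub_mul, Finset.sum_sub_distrib, sub_eq_zero,
    Pi.single_apply]

theorem mem_solutions_inr {F : Type} [Field F] {H : Submodule ℝ (Fin n → ℝ)} {k : ClanTuple m}
    {x : ClanVar m → F} :
    x ∈ solutions F (clanEquations E m (Sum.inr (H, k))) ↔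
      ∀ a ∈ E H, ∑ i, (a i : F) * pickPoint k x i = 0 := by
  simp [mem_solutions, clanEquations, sum_pullForm]

theorem solutions_clanEquations (hE : IsIntegralEquations A E) {j : ClanIndex m}
    (hj : j ∈ clanIndices A m) : solutions ℝ (clanEquations E m j) = clanMember m j := by
  ext x
  rcases j with ⟨i, r, s⟩ | ⟨H, k⟩
  · rw [mem_solutions_inl]
    simp [clanMember, diagonal, sub_eq_zero]
  · rw [mem_solutions_inr, ← hE H (inr_mem_clanIndices.mp hj).1]
    have : pickPoint k x = pick m k x := by
      ext i
      simp only [pickPoint, pick, LinearMap.pi_apply]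
      split_ifs <;> rfl
    rw [this]
    rfl

theorem coeff_eq_zero_of_notMem_supp (hE : IsIntegralEquations A E)
    {H : Submodule ℝ (Fin n → ℝ)} (hH : H ∈ A) {a : Fin n → ℤ} (ha : a ∈ E H) {i : Fin n}
    (hi : i ∉ supp H) : a i = 0 := by
  have h := (hE H hH _).mp (not_not.mp hi) a ha
  simpa [Pi.single_apply] using h

open Classical in
/-- The sets of colors given by a point with coordinates `x_{ir}`. -/
def colorSets {F : Type} (x : ClanVar m → F) (i : Fin n) : Finset F :=
  Finset.univ.image fun r => x ⟨i, r⟩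

theorem card_colorSets {F : Type} {x : ClanVar m → F} {i : Fin n} :
    (colorSets x i).card = m i ↔ Function.Injective fun r => x ⟨i, r⟩ := by
  classical
  have := Finset.card_image_iff (s := (Finset.univ : Finset (Fin (m i)))) (f := fun r => x ⟨i, r⟩)
  rw [Finset.card_univ, Fintype.card_fin, Finset.coe_univ, Set.injOn_univ] at this
  exact this

/-- Avoiding the diagonals means that the color sets have full size; avoiding the other members
means that no tuple `k` selects a solution of some `H`. -/
theorem isMultiColoring_colorSets_iff (hE : IsIntegralEquations A E) {F : Type} [Field F]
    {x : ClanVar m → F} :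
    IsMultiColoring A E m F (colorSets x) ↔
      ∀ j ∈ clanIndices A m, x ∉ solutions F (clanEquations E m j) := by
  constructor
  · rintro ⟨hcard, hH⟩ (⟨i, r, s⟩ | ⟨H, k⟩) hj hx
    · exact inl_mem_clanIndices.mp hj (card_colorSets.mp (hcard i) (mem_solutions_inl.mp hx))
    · obtain ⟨hHA, hsupp⟩ := inr_mem_clanIndices.mp hj
      refine hH H hHA ⟨pickPoint k x, fun i hi => ?_, mem_solutions_inr.mp hx⟩
      have : m i ≠ 0 := hsupp hi
      simp [pickPoint, this, colorSets]
  · intro h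
    refine ⟨fun i => card_colorSets.mpr fun r s hrs => ?_, ?_⟩
    · by_contra hne
      exact h (Sum.inl ⟨i, r, s⟩) (inl_mem_clanIndices.mpr hne) (mem_solutions_inl.mpr hrs)
    · rintro H hH ⟨y, hy, hyE⟩
      have hy' : ∀ i ∈ supp H, ∃ r, x ⟨i, r⟩ = y i := fun i hi => by
        simpa [colorSets] using hy i hi
      have hsupp : supp H ⊆ {i | m i ≠ 0} := fun i hi h0 =>
        (h0 ▸ (hy' i hi).choose : Fin 0).elim0
      -- Off `supp H` any index will do, because the equations of `H` have zero coefficients there.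
      have hk : ∀ i : {i // m i ≠ 0}, ∃ r, i.1 ∈ supp H → x ⟨i.1, r⟩ = y i.1 := fun i => by
        by_cases hi : i.1 ∈ supp H
        · obtain ⟨r, hr⟩ := hy' i.1 hi
          exact ⟨r, fun _ => hr⟩
        · exact ⟨⟨0, Nat.pos_of_ne_zero i.2⟩, fun h => absurd h hi⟩
      choose k hk using hk
      refine h (Sum.inr (H, k)) (inr_mem_clanIndices.mpr ⟨hH, hsupp⟩)
        (mem_solutions_inr.mpr fun a ha => ?_)
      rw [← hyE a ha]
      refine Finset.sum_congr rfl fun i _ => ?_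
      by_cases hi : i ∈ supp H
      · have hmi : m i ≠ 0 := hsupp hi
        rw [pickPoint, dif_pos hmi, hk ⟨i, hmi⟩ hi]
      · rw [coeff_eq_zero_of_notMem_supp hE hH ha hi]
        simp

theorem card_fiber_colorSets {F : Type} {C : Fin n → Finset F} (hC : ∀ i, (C i).card = m i) :
    Nat.card {x : ClanVar m → F // colorSets x = C} = ∏ i, (m i).factorial := by
  classical
  -- A point of the fibre is an enumeration of each `C i`.
  let g : ((i : Fin n) → (Fin (m i) ≃ C i)) → {x : ClanVar m → F // colorSets x = C} :=
    fun σ => ⟨fun v => σ v.1 v.2, by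
      ext i c
      simp only [colorSets, Finset.mem_image, Finset.mem_univ, true_and]
      exact ⟨fun ⟨r, hr⟩ => hr ▸ (σ i r).2, fun hc => ⟨(σ i).symm ⟨c, hc⟩, by simp⟩⟩⟩
  have hg : Function.Bijective g := by
    constructor
    · intro σ τ h
      funext i
      ext r
      exact congrFun (congrArg Subtype.val h) ⟨i, r⟩
    · rintro ⟨x, rfl⟩
      refine ⟨fun i => Equiv.ofBijective (fun r => ⟨x ⟨i, r⟩, by simp [colorSets]⟩) ⟨?_, ?_⟩, rfl⟩
      · intro r s h
        exact card_colorSets.mp (hC i) (congrArg Subtype.val h)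
      · rintro ⟨c, hc⟩
        obtain ⟨r, -, hr⟩ := Finset.mem_image.mp hc
        exact ⟨r, Subtype.ext hr⟩
  rw [← Nat.card_congr (Equiv.ofBijective g hg), Nat.card_pi]
  refine Finset.prod_congr rfl fun i _ => ?_
  rw [Nat.card_eq_fintype_card, Fintype.card_equiv (Fintype.equivOfCardEq (by simp [hC]))]
  simp

theorem card_complement_eq (hE : IsIntegralEquations A E) {F : Type} [Field F] [Finite F] :
    Nat.card {x : ClanVar m → F // ∀ j ∈ clanIndices A m,
        x ∉ solutions F (clanEquations E m j)} =
      Nat.card {C : Fin n → Finset F // IsMultiColoring A E m F C} *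
        ∏ i, (m i).factorial := by
  classical
  let g : {x : ClanVar m → F // ∀ j ∈ clanIndices A m,
      x ∉ solutions F (clanEquations E m j)} → {C : Fin n → Finset F // IsMultiColoring A E m F C} :=
    fun x => ⟨colorSets x.1, (isMultiColoring_colorSets_iff hE).mpr x.2⟩
  have hfib : ∀ C, Nat.card {x // g x = C} = ∏ i, (m i).factorial := by
    intro C
    rw [← card_fiber_colorSets C.2.1]
    refine Nat.card_congr ⟨fun x => ⟨x.1.1, congrArg Subtype.val x.2⟩,
      fun x => ⟨⟨x.1, (isMultiColoring_colorSets_iff hE).mp (by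
        rw [x.2]; exact C.2)⟩, Subtype.ext x.2⟩,
      fun _ => rfl, fun _ => rfl⟩
  have : Fintype F := Fintype.ofFinite F
  rw [← Nat.card_congr (Equiv.sigmaFiberEquiv g), Nat.card_sigma, Finset.sum_congr rfl
    fun C _ => hfib C, Finset.sum_const, smul_eq_mul, Finset.card_univ, Nat.card_eq_fintype_card]

theorem countsMultiColorings_charPoly (hA : IsHyperplaneArrangement A)
    (hE : IsIntegralEquations A E) :
    CountsMultiColorings A E m
      (Polynomial.C (∏ i, ((m i).factorial : ℚ))⁻¹ * charPoly (clan A m)) := by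
  obtain ⟨N, hN⟩ := exists_card_complement (clanIndices A m) (clanEquations E m)
  refine ⟨N, fun F _ _ hF => ?_⟩
  have h : whitneyPoly (clanIndices A m) (fun j => solutions ℝ (clanEquations E m j)) ⊤ =
      charPoly (clan A m) := by
    rw [charPoly_clan hA]
    refine Finset.sum_congr rfl fun T hT => ?_
    rw [Finset.inf_congr rfl fun j hj =>
      solutions_clanEquations hE (Finset.mem_powerset.mp hT hj)]
  rw [Polynomial.eval_mul, Polynomial.eval_C, ← h, hN F hF, card_complement_eq hE]
  have h0 : (∏ i, ((m i).factorial : ℚ)) ≠ 0 :=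
    Finset.prod_ne_zero_iff.mpr fun i _ => by exact_mod_cast (m i).factorial_ne_zero
  push_cast
  field_simp

theorem CountsMultiColorings.unique {P Q : ℚ[X]} (hP : CountsMultiColorings A E m P)
    (hQ : CountsMultiColorings A E m Q) : P = Q := by
  obtain ⟨N, hN⟩ := hP
  obtain ⟨N', hN'⟩ := hQ
  refine Polynomial.eq_of_infinite_eval_eq P Q ?_
  refine Set.infinite_of_not_bddAbove ?_
  rintro ⟨c, hc⟩
  obtain ⟨p, hp, hpp⟩ := Nat.exists_infinite_primes (max (max N N') ⌈c⌉₊ + 1)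
  have : Fact p.Prime := ⟨hpp⟩
  have hchar : ringChar (ZMod p) = p := ZMod.ringChar_zmod_n p
  have h1 := hN (ZMod p) (by omega)
  have h2 := hN' (ZMod p) (by omega)
  rw [Nat.card_zmod] at h1 h2
  have hpc : (p : ℚ) ≤ ⌈c⌉₊ := (hc (h1.trans h2.symm)).trans (Nat.le_ceil c)
  have : p ≤ ⌈c⌉₊ := by exact_mod_cast hpc
  omega

/-- The right-hand side counts for every choice of integral equations, hence also for those behind
the chosen polynomial, and uniqueness applies. -/
theorem chromaticPoly_eq (hA : IsHyperplaneArrangement A) (m : Fin n →₀ ℕ) :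
    chromaticPoly A m =
      Polynomial.C (∏ i, ((m i).factorial : ℚ))⁻¹ * charPoly (clan A m) := by
  unfold chromaticPoly
  split_ifs with h
  · obtain ⟨E, hE, hc⟩ := h.choose_spec
    exact hc.unique (countsMultiColorings_charPoly hA hE)
  · rfl

end Colorings

/-! ### The powers of the independence series -/

section Series

variable {n : ℕ} {A : Finset (Submodule ℝ (Fin n → ℝ))}

theorem constantCoeff_chromaticSeries (hA : IsHyperplaneArrangement A) :
    MvPowerSeries.constantCoeff (R := RatFunc ℚ)
      (fun m : Fin n →₀ ℕ => algebraMap ℚ[X] (RatFunc ℚ) (chromaticPoly A m)) = 1 := by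
  change algebraMap ℚ[X] (RatFunc ℚ) (chromaticPoly A 0) = 1
  rw [chromaticPoly_eq hA, charPoly_clan_zero hA]
  simp

theorem coeff_power_independenceSeries (hA : IsHyperplaneArrangement A) (m : Fin n →₀ ℕ) :
    MvPowerSeries.coeff m (power (independenceSeries A) RatFunc.X) =
      algebraMap ℚ[X] (RatFunc ℚ) (chromaticPoly A m) :=
  congrArg (MvPowerSeries.coeff m) <| power_power_of_mul_eq_one (constantCoeff_chromaticSeries hA)
    (mul_inv_cancel₀ RatFunc.X_ne_zero)

theorem coeff_power_independenceSeriesNeg (hA : IsHyperplaneArrangement A) (m : Fin n →₀ ℕ) :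
    MvPowerSeries.coeff m (power (independenceSeriesNeg A) RatFunc.X) =
      algebraMap ℚ[X] (RatFunc ℚ) ((-1) ^ m.degree * chromaticPoly A m) := by
  have h : (independenceSeries A).constantCoeff = 1 :=
    constantCoeff_power (constantCoeff_chromaticSeries hA) _
  rw [independenceSeriesNeg, ← rescale_power _ h, MvPowerSeries.coeff_rescale,
    coeff_power_independenceSeries hA, map_mul, map_pow, map_neg, map_one]
  congr 1
  rw [Finsupp.prod, Finset.prod_pow_eq_pow_sum]
  rfl

/-- The coefficients lie in the image of `ℚ[X]`, so evaluation never meets a vanishing denominator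
and its default value plays no role. -/
theorem coeff_specialize_power_independenceSeriesNeg (hA : IsHyperplaneArrangement A)
    (m : Fin n →₀ ℕ) (c : ℚ) :
    MvPowerSeries.coeff m (specialize (power (independenceSeriesNeg A) RatFunc.X) c) =
      (-1) ^ m.degree * (charPoly (clan A m)).eval c / ∏ i, ((m i).factorial : ℚ) := by
  change RatFunc.eval (RingHom.id ℚ) c (MvPowerSeries.coeff m _) = _
  rw [coeff_power_independenceSeriesNeg hA, RatFunc.eval_algebraMap, Algebra.algebraMap_self_apply,
    chromaticPoly_eq hA, Polynomial.eval₂_id]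
  simp only [Polynomial.eval_mul, Polynomial.eval_pow, Polynomial.eval_neg, Polynomial.eval_one,
    Polynomial.eval_C]
  ring

end Series

end SubspaceArrangement

end

theorem mainTheorem3 {n : ℕ} (A : Finset (Submodule ℝ (Fin n → ℝ)))
    (hA : SubspaceArrangement.IsHyperplaneArrangement A) :
    -- for all integral equations of `A`, the polynomial `Π_m` counts the multi-colorings
    (∀ E, SubspaceArrangement.IsIntegralEquations A E → ∀ m : Fin n →₀ ℕ,
      SubspaceArrangement.CountsMultiColorings A E m (SubspaceArrangement.chromaticPoly A m)) ∧
    -- `I(A, x) ^ t = ∑ Π_m(t) x^m` and `I(A, -x) ^ t = ∑ (-1)^|m| Π_m(t) x^m`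
    (∀ m : Fin n →₀ ℕ,
      MvPowerSeries.coeff m
          (SubspaceArrangement.power (SubspaceArrangement.independenceSeries A) RatFunc.X) =
        algebraMap (Polynomial ℚ) (RatFunc ℚ) (SubspaceArrangement.chromaticPoly A m) ∧
      MvPowerSeries.coeff m
          (SubspaceArrangement.power (SubspaceArrangement.independenceSeriesNeg A) RatFunc.X) =
        algebraMap (Polynomial ℚ) (RatFunc ℚ)
          ((-1) ^ m.degree * SubspaceArrangement.chromaticPoly A m)) ∧
    -- `I(A, -x) ^ (-q)`, the specialization `t = -q`, has the coefficients
    -- `(-1)^|m| χ_{A(m)}(-q) / m!`, and these are nonnegative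
    (∀ (q : ℕ) (m : Fin n →₀ ℕ),
      MvPowerSeries.coeff m
          (SubspaceArrangement.specialize
            (SubspaceArrangement.power (SubspaceArrangement.independenceSeriesNeg A) RatFunc.X)
            (-(q : ℚ))) =
        (-1) ^ m.degree *
          (SubspaceArrangement.charPoly (SubspaceArrangement.clan A m)).eval (-(q : ℚ)) /
            ∏ i, ((m i).factorial : ℚ) ∧
      0 ≤ MvPowerSeries.coeff m
          (SubspaceArrangement.specialize
            (SubspaceArrangement.power (SubspaceArrangement.independenceSeriesNeg A) RatFunc.X)
            (-(q : ℚ))) ∧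
      0 ≤ (-1) ^ m.degree *
          (SubspaceArrangement.charPoly (SubspaceArrangement.clan A m)).eval (-(q : ℚ)) /
            ∏ i, ((m i).factorial : ℚ)) := by
  refine ⟨fun E hE m => ?_, fun m => ⟨?_, ?_⟩, fun q m => ?_⟩
  · rw [SubspaceArrangement.chromaticPoly_eq hA]
    exact SubspaceArrangement.countsMultiColorings_charPoly hA hE
  · exact SubspaceArrangement.coeff_power_independenceSeries hA m
  · exact SubspaceArrangement.coeff_power_independenceSeriesNeg hA m
  · have h := div_nonneg (SubspaceArrangement.charPoly_clan_eval_neg_nonneg hA m q)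
      (Finset.prod_nonneg fun i (_ : i ∈ Finset.univ) => Nat.cast_nonneg (α := ℚ) (m i).factorial)
    have h' := SubspaceArrangement.coeff_specialize_power_independenceSeriesNeg hA m (-(q : ℚ))
    exact ⟨h', h'.symm ▸ h, h⟩
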